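/- Let $R\in\mathbb{R}[\xi]^{g\times \mathtt{w}}$, $M\in\mathbb{R}[\xi]^{g\times \mathtt{c}}$ and $S\in\mathbb{R}[\xi]^{s\times \mathtt{w}}$ be polynomial matrices. For a polynomial matrix $A$ with $q$ columns, $\ker A(\tfrac{d}{dt})$ denotes the set of all $x\in C^\infty(\mathbb{R},\mathbb{R}^q)$ with $A(\tfrac{d}{dt})x=0$, and ranks of polynomial matrices are taken over the field $\mathbb{R}(\xi)$. Define the full plant behavior, the specification, the control manifest behavior and the canonical controller by $$\mathcal{P}_{\mathrm{full}}=\{(w,c)\in C^\infty(\mathbb{R},\mathbb{R}^{\mathtt{w}})\times C^\infty(\mathbb{R},\mathbb{R}^{\mathtt{c}}) : R(\tfrac{d}{dt})w+M(\tfrac{d}{dt})c=0\},\qquad \mathcal{S}=\ker S(\tfrac{d}{dt}),$$ $$\mathcal{P}_c=\{c : \exists\, w,\ (w,c)\in\mathcal{P}_{\mathrm{full}}\},\qquad \mathcal{C}_{\mathrm{can}}=\{c : \exists\, w\in\mathcal{S},\ (w,c)\in\mathcal{P}_{\mathrm{full}}\}.$$ A controller is a set of the form $\mathcal{C}=\ker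 C(\tfrac{d}{dt})\subseteq C^\infty(\mathbb{R},\mathbb{R}^{\mathtt{c}})$ with $C$ a polynomial matrix with $\mathtt{c}$ columns, which can be taken to be of full row rank; it is regular if, for such a full row rank $C$, $$\operatorname{rank}\begin{bmatrix}R&M\\0&C\end{bmatrix}=\operatorname{rank}\begin{bmatrix}R&M\end{bmatrix}+\operatorname{rank}C .$$ Let $\mathfrak{C}_{\mathrm{can}}^{\mathrm{reg}}$ be the set of all regular controllers $\mathcal{C}$ with $\mathcal{C}\cap\mathcal{P}_c=\mathcal{C}_{\mathrm{can}}\cap\mathcal{P}_c$. Theorem. Let $\mathcal{P}_c=\ker P_c(\tfrac{d}{dt})$ and let $\mathcal{C}=\ker C(\tfrac{d}{dt})$ be an element of $\mathfrak{C}_{\mathrm{can}}^{\mathrm{reg}}$, where $P_c\in\mathbb{R}[\xi]^{p\times\mathtt{c}}$ and $C\in\mathbb{R}[\xi]^{k\times\mathtt{c}}$ have full row rank. Then a set $\mathcal{C}'\subseteq C^\infty(\mathbb{R},\mathbb{R}^{\mathtt{c}})$ belongs to $\mathfrak{C}_{\mathrm{can}}^{\mathrm{reg}}$ if and only if $\mathcal{C}'=\ker\,(VP_c+C)(\tfrac{d}{dt})$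 for some polynomial matrix $V\in\mathbb{R}[\xi]^{k\times p}$. -/

import Mathlib

open scoped Polynomial ContDiff

noncomputable section

namespace Behavior

/-- The real vector space `C^∞(ℝ, ℝ)` of infinitely differentiable scalar signals. -/
def Smooth : Submodule ℝ (ℝ → ℝ) where
  carrier := {f | ContDiff ℝ ∞ f}
  add_mem' := fun {f g} (hf : ContDiff ℝ ∞ f) (hg : ContDiff ℝ ∞ g) =>
    show ContDiff ℝ ∞ (f + g) from hf.add hg
  zero_mem' := show ContDiff ℝ ∞ (fun _ : ℝ => (0 : ℝ)) from contDiff_const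
  smul_mem' := fun a f (hf : ContDiff ℝ ∞ f) =>
    show ContDiff ℝ ∞ (a • f) from contDiff_const.smul hf

theorem mem_smooth {f : ℝ → ℝ} : f ∈ Smooth ↔ ContDiff ℝ ∞ f := Iff.rfl

theorem differentiable_smooth (f : Smooth) : Differentiable ℝ f.1 :=
  (mem_smooth.mp f.2).differentiable (by simp)

/-- The derivative of an infinitely differentiable function is infinitely differentiable. -/
theorem deriv_mem_smooth {f : ℝ → ℝ} (hf : f ∈ Smooth) : deriv f ∈ Smooth :=
  mem_smooth.mpr (contDiff_infty_iff_deriv.mp (mem_smooth.mp hf)).2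

/-- Differentiation `d/dt`, as a linear operator on `C^∞(ℝ, ℝ)`. -/
def ddt : Smooth →ₗ[ℝ] Smooth where
  toFun f := ⟨deriv f.1, deriv_mem_smooth f.2⟩
  map_add' f g := by
    apply Subtype.ext
    funext t
    exact deriv_add (differentiable_smooth f t) (differentiable_smooth g t)
  map_smul' a f := by
    apply Subtype.ext
    funext t
    exact deriv_const_smul a (differentiable_smooth f t)

/-- Trajectories: elements of `C^∞(ℝ, ℝ^q)`, given by their `q` smooth components. -/
abbrev Traj (q : ℕ) : Type := Fin q → Smooth

/-- The differential operator `A(d/dt)` of a polynomial matrix `A`: the `i`-th component of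
`A(d/dt) w` is `∑ j, A i j (d/dt) (w j)`. -/
def diffOp {g q : ℕ} (A : Matrix (Fin g) (Fin q) ℝ[X]) (w : Traj q) : Traj g :=
  fun i => ∑ j, Polynomial.aeval ddt (A i j) (w j)

/-- The behavior `ker A(d/dt)`. -/
def ker {g q : ℕ} (A : Matrix (Fin g) (Fin q) ℝ[X]) : Set (Traj q) :=
  {w | diffOp A w = 0}

/-- The rank of a polynomial matrix, i.e. its rank over the field of rational functions. -/
def polyRank {m n : Type} [Fintype n] (A : Matrix m n ℝ[X]) : ℕ :=
  (A.map (algebraMap ℝ[X] (RatFunc ℝ))).rank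

/-- A polynomial matrix has full row rank if its rank is its number of rows. -/
def FullRowRank {g q : ℕ} (A : Matrix (Fin g) (Fin q) ℝ[X]) : Prop :=
  polyRank A = g

section Plant

variable {g nw nc : ℕ} (R : Matrix (Fin g) (Fin nw) ℝ[X]) (M : Matrix (Fin g) (Fin nc) ℝ[X])

/-- The full plant behavior: all smooth `(w, c)` with `R(d/dt) w + M(d/dt) c = 0`. -/
def fullPlant : Set (Traj nw × Traj nc) :=
  {x | diffOp R x.1 + diffOp M x.2 = 0}

/-- The control manifest behavior: the projection of the full plant behavior onto `c`. -/
def controlManifest : Set (Traj nc) :=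
  {c | ∃ w : Traj nw, (w, c) ∈ fullPlant R M}

/-- The canonical controller of the plant for the specification `𝒮`. -/
def canonicalController (𝒮 : Set (Traj nw)) : Set (Traj nc) :=
  {c | ∃ w : Traj nw, (w, c) ∈ fullPlant R M ∧ w ∈ 𝒮}

/-- `𝒞` is a regular controller for the plant: it is the kernel of some full row rank
polynomial matrix `C` (with any number `k` of rows, `k = 0` included) such that
`rank [R M; 0 C] = rank [R M] + rank C`. -/
def IsRegularController (𝒞 : Set (Traj nc)) : Prop :=
  ∃ (k : ℕ) (C : Matrix (Fin k) (Fin nc) ℝ[X]),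
    FullRowRank C ∧ 𝒞 = ker C ∧
      polyRank (Matrix.fromBlocks R M 0 C) = polyRank (Matrix.fromCols R M) + polyRank C

/-- The class of regular controllers that are equivalent to the canonical controller, i.e.
that allow the same control trajectories of the plant. -/
def canReg (𝒮 : Set (Traj nw)) : Set (Set (Traj nc)) :=
  {𝒞 | IsRegularController R M 𝒞 ∧
    𝒞 ∩ controlManifest R M = canonicalController R M 𝒮 ∩ controlManifest R M}

end Plant

end Behavior

end

/-! The signal space `Smooth`, with `X` acting as `d/dt`, is an injective cogenerator over the PID
`ℝ[X]`: nonzero scalar operators are surjective, and nonunits have nonzero kernel. Hence any row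
operator vanishing on `ker A` is a polynomial combination of the rows of `A`
(`exists_vecMul_eq_of_annihilates`), so inclusions of behaviors become matrix factorizations.

In particular `Pc = Y * M` with `Y * R = 0`, so adding `V * Pc` to a controller is a row operation
with plant rows and preserves regularity. Conversely, if `C` and `C'` have the same intersection
with `ker Pc`, each is a multiple of the other modulo the rows of `Pc`. Regularity makes their rows
independent modulo those of `Pc`, so the two coefficient matrices are mutually inverse
(`mul_eq_one_of_independent`); normalizing `C'` by one of them gives the form `V * Pc + C`. -/

namespace Behavior

open Polynomial

/-! ### Scalar differential operators: surjectivity and kernels -/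

/-- Smooth signals as a module over `ℝ[X]`, with `X` acting as `d/dt`. -/
noncomputable instance smoothPolynomialModule : Module ℝ[X] Smooth :=
  Module.compHom Smooth (aeval (R := ℝ) ddt).toRingHom

theorem poly_smul_def (p : ℝ[X]) (f : Smooth) : p • f = aeval ddt p f := rfl

theorem X_sub_C_smul_apply (a : ℝ) (f : Smooth) (t : ℝ) :
    (((X - C a : ℝ[X]) • f : Smooth)).1 t = deriv f.1 t - a * f.1 t := by
  rw [poly_smul_def]
  simp only [map_sub, aeval_X, aeval_C, LinearMap.sub_apply, Module.algebraMap_end_apply]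
  rfl

theorem C_smul_apply (a : ℝ) (f : Smooth) (t : ℝ) :
    (((C a : ℝ[X]) • f : Smooth)).1 t = a * f.1 t := by
  rw [poly_smul_def]
  simp only [aeval_C, Module.algebraMap_end_apply]
  rfl

theorem exists_smooth_primitive (g : Smooth) (c : ℝ) :
    ∃ F : Smooth, (∀ t, HasDerivAt F.1 (g.1 t) t) ∧ F.1 0 = c := by
  have hg : Continuous g.1 := (mem_smooth.mp g.2).continuous
  have hd : ∀ t, HasDerivAt (fun t => c + ∫ s in (0 : ℝ)..t, g.1 s) (g.1 t) t := fun t =>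
    (intervalIntegral.integral_hasDerivAt_right (hg.intervalIntegrable _ _)
      (hg.stronglyMeasurableAtFilter _ _) hg.continuousAt).const_add c
  refine ⟨⟨fun t => c + ∫ s in (0 : ℝ)..t, g.1 s, ?_⟩, hd, by simp⟩
  rw [mem_smooth, contDiff_infty_iff_deriv]
  refine ⟨fun t => (hd t).differentiableAt, ?_⟩
  rw [show deriv (fun t => c + ∫ s in (0 : ℝ)..t, g.1 s) = g.1 from funext fun t => (hd t).deriv]
  exact g.2

/-- The planar system `u' = a u - b v + g`, `v' = a v + b u` is solvable with `u(0)` prescribed. -/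
theorem exists_planar_solution (a b c : ℝ) (g : Smooth) :
    ∃ u v : Smooth, (X - C a : ℝ[X]) • u = g - (C b : ℝ[X]) • v ∧
      (X - C a : ℝ[X]) • v = (C b : ℝ[X]) • u ∧ u.1 0 = c := by
  have hg : ContDiff ℝ ∞ g.1 := g.2
  -- Variation of constants: `z = u + iv` solves `z' = (a + ib) z + g`, so `z = exp((a + ib)t) (F -
  -- iG)` with `F - iG = c + ∫ exp(-(a + ib)s) g(s) ds`.
  obtain ⟨F, hF, hF0⟩ := exists_smooth_primitive
    ⟨fun t => Real.cos (b * t) * (Real.exp (-(a * t)) * g.1 t), mem_smooth.mpr (by fun_prop)⟩ c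
  obtain ⟨G, hG, hG0⟩ := exists_smooth_primitive
    ⟨fun t => Real.sin (b * t) * (Real.exp (-(a * t)) * g.1 t), mem_smooth.mpr (by fun_prop)⟩ 0
  have hFs : ContDiff ℝ ∞ F.1 := F.2
  have hGs : ContDiff ℝ ∞ G.1 := G.2
  have hexp (t : ℝ) : HasDerivAt (fun t => Real.exp (a * t)) (Real.exp (a * t) * a) t := by
    simpa using ((hasDerivAt_id t).const_mul a).exp
  have hcos (t : ℝ) : HasDerivAt (fun t => Real.cos (b * t)) (-Real.sin (b * t) * b) t := by
    simpa using ((hasDerivAt_id t).const_mul b).cos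
  have hsin (t : ℝ) : HasDerivAt (fun t => Real.sin (b * t)) (Real.cos (b * t) * b) t := by
    simpa using ((hasDerivAt_id t).const_mul b).sin
  have hinv (t : ℝ) : Real.exp (a * t) * Real.exp (-(a * t)) = 1 := by
    rw [← Real.exp_add]; simp
  refine ⟨⟨fun t => Real.exp (a * t) * (Real.cos (b * t) * F.1 t + Real.sin (b * t) * G.1 t),
      mem_smooth.mpr (by fun_prop)⟩,
    ⟨fun t => Real.exp (a * t) * (Real.sin (b * t) * F.1 t - Real.cos (b * t) * G.1 t),
      mem_smooth.mpr (by fun_prop)⟩, ?_, ?_, ?_⟩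
  · ext t
    have h := (hexp t).mul (((hcos t).mul (hF t)).add ((hsin t).mul (hG t)))
    rw [X_sub_C_smul_apply]
    refine (congrArg (· - _) h.deriv).trans ?_
    change _ = g.1 t - _
    rw [C_smul_apply]
    simp only [Pi.add_apply, Pi.mul_apply]
    linear_combination (g.1 t) * hinv t + Real.exp (a * t) * Real.exp (-(a * t)) * g.1 t *
      Real.sin_sq_add_cos_sq (b * t)
  · ext t
    have h := (hexp t).mul (((hsin t).mul (hF t)).sub ((hcos t).mul (hG t)))
    rw [X_sub_C_smul_apply]
    refine (congrArg (· - _) h.deriv).trans ?_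
    rw [C_smul_apply]
    simp only [Pi.sub_apply, Pi.mul_apply]
    ring
  · simp [hF0, hG0]

/-- Take a complex root `a + ib`. The quadratic case is written as `(X - a)² + b²` so that it arises
by applying `X - a` twice in the planar system. -/
theorem exists_monic_factor_of_prime {p : ℝ[X]} (hp : Prime p) :
    ∃ a b : ℝ, Associated (X - C a) p ∨
      (b ≠ 0 ∧ Associated ((X - C a) * (X - C a) + C b * C b) p) := by
  have hdeg : p.degree ≠ 0 := fun h => hp.not_isUnit (isUnit_iff_degree_eq_zero.mpr h)
  obtain ⟨z, hz⟩ := IsAlgClosed.exists_aeval_eq_zero ℂ p hdeg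
  by_cases him : z.im = 0
  · refine ⟨z.re, 0, Or.inl ?_⟩
    have hroot : p.IsRoot z.re := by
      have hzr : z = algebraMap ℝ ℂ z.re := Complex.ext (by simp) (by simp [him])
      rw [hzr, aeval_algebraMap_apply] at hz
      simpa using hz
    exact (irreducible_X_sub_C _).associated_of_dvd hp.irreducible (dvd_iff_isRoot.mpr hroot)
  · have hdvd := quadratic_dvd_of_aeval_eq_zero_im_ne_zero p hz him
    have heq : X ^ 2 - C (2 * z.re) * X + C (‖z‖ ^ 2) =
        (X - C z.re) * (X - C z.re) + C z.im * C z.im := by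
      rw [Complex.sq_norm, Complex.normSq_apply]
      simp only [map_mul, map_add, map_ofNat]
      ring
    rw [heq] at hdvd
    refine ⟨z.re, z.im, Or.inr ⟨him, (hp.irreducible.dvd_iff.mp hdvd).resolve_left ?_ |>.symm⟩⟩
    intro hu
    have := natDegree_eq_zero_of_isUnit hu
    rw [← heq] at this
    have h2 : (X ^ 2 - C (2 * z.re) * X + C (‖z‖ ^ 2) : ℝ[X]).natDegree = 2 := by
      compute_degree!
    omega

theorem smul_surjective_of_associated {p q : ℝ[X]} (h : Associated q p)
    (hq : ∀ g : Smooth, ∃ f : Smooth, q • f = g) (g : Smooth) : ∃ f : Smooth, p • f = g := by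
  obtain ⟨r, hr⟩ := h.symm.dvd
  obtain ⟨f, hf⟩ := hq g
  exact ⟨r • f, by rw [← mul_smul, ← hr, hf]⟩

theorem smul_surjective_of_prime {p : ℝ[X]} (hp : Prime p) (g : Smooth) :
    ∃ f : Smooth, p • f = g := by
  obtain ⟨a, b, h | ⟨hb, h⟩⟩ := exists_monic_factor_of_prime hp
  · refine smul_surjective_of_associated h (fun g => ?_) g
    obtain ⟨u, v, hu, -, -⟩ := exists_planar_solution a 0 0 g
    exact ⟨u, by simpa using hu⟩
  · refine smul_surjective_of_associated h (fun g => ?_) g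
    -- For forcing `h`, the component `v` satisfies `((X - a)² + b²) v = b h`; hence `h = b⁻¹ g`.
    obtain ⟨u, v, hu, hv, -⟩ := exists_planar_solution a b 0 ((C b⁻¹ : ℝ[X]) • g)
    refine ⟨v, ?_⟩
    rw [add_smul, mul_smul, hv, smul_comm, hu, smul_sub, ← mul_smul, ← mul_smul, ← C_mul,
      mul_inv_cancel₀ hb]
    simp

/-- Nonzero scalar constant-coefficient operators are surjective on smooth signals. -/
theorem smul_surjective {p : ℝ[X]} (hp : p ≠ 0) (g : Smooth) : ∃ f : Smooth, p • f = g := by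
  induction p using UniqueFactorizationMonoid.induction_on_prime generalizing g with
  | h₁ => exact absurd rfl hp
  | h₂ u hu =>
    obtain ⟨v, hv⟩ := hu.exists_right_inv
    exact ⟨v • g, by rw [← mul_smul, hv, one_smul]⟩
  | h₃ r q hr hq ih =>
    obtain ⟨f, hf⟩ := smul_surjective_of_prime hq g
    obtain ⟨f', hf'⟩ := ih hr f
    exact ⟨f', by rw [mul_smul, hf', hf]⟩

theorem ne_zero_of_apply_zero_eq_one {f : Smooth} (hf : f.1 0 = 1) : f ≠ 0 := by
  rintro rfl
  exact zero_ne_one hf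

/-- The kernel of a scalar operator given by a nonunit is nonzero. -/
theorem exists_ne_zero_smul_eq_zero {d : ℝ[X]} (hd : ¬ IsUnit d) :
    ∃ f : Smooth, f ≠ 0 ∧ d • f = 0 := by
  by_cases h0 : d = 0
  · obtain ⟨u, -, -, -, hu⟩ := exists_planar_solution 0 0 1 0
    exact ⟨u, ne_zero_of_apply_zero_eq_one hu, by rw [h0, zero_smul]⟩
  obtain ⟨p, hpi, hpd⟩ := WfDvdMonoid.exists_irreducible_factor hd h0
  obtain ⟨a, b, h⟩ := exists_monic_factor_of_prime hpi.prime
  suffices H : ∃ (q : ℝ[X]) (f : Smooth), q ∣ d ∧ f ≠ 0 ∧ q • f = 0 by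
    obtain ⟨q, f, ⟨r, rfl⟩, hf, hqf⟩ := H
    exact ⟨f, hf, by rw [mul_comm, mul_smul, hqf, smul_zero]⟩
  rcases h with h | ⟨-, h⟩
  · obtain ⟨u, v, hu, -, hu0⟩ := exists_planar_solution a 0 1 0
    exact ⟨_, u, h.dvd.trans hpd, ne_zero_of_apply_zero_eq_one hu0, by simpa using hu⟩
  · obtain ⟨u, v, hu, hv, hu0⟩ := exists_planar_solution a b 1 0
    refine ⟨_, u, h.dvd.trans hpd, ne_zero_of_apply_zero_eq_one hu0, ?_⟩
    rw [add_smul, mul_smul, hu, zero_sub, smul_neg, smul_comm, hv, ← mul_smul]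
    simp

/-! ### Injectivity, cogeneration and annihilators -/

/-- Divisibility implies injectivity over a PID: a map on the ideal `(d)` is determined by its value
at `d`, and dividing that value by `d` extends the map. -/
theorem baer_smooth : Module.Baer ℝ[X] Smooth := by
  intro I g
  obtain ⟨d, rfl⟩ := (IsPrincipalIdealRing.principal I).principal
  have hd : d ∈ Submodule.span ℝ[X] {d} := Submodule.mem_span_singleton_self d
  obtain ⟨f, hf⟩ : ∃ f : Smooth, d • f = g ⟨d, hd⟩ := by
    by_cases h0 : d = 0
    · subst h0
      exact ⟨0, by rw [smul_zero]; exact (map_zero g).symm⟩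
    · exact smul_surjective h0 _
  refine ⟨LinearMap.toSpanSingleton ℝ[X] Smooth f, fun x hx => ?_⟩
  obtain ⟨r, rfl⟩ := Submodule.mem_span_singleton.mp hx
  have : (⟨r • d, hx⟩ : Submodule.span ℝ[X] {d}) = r • ⟨d, hd⟩ := rfl
  rw [this, map_smul g, ← hf, LinearMap.toSpanSingleton_apply, smul_eq_mul, mul_smul]

/-- Smooth signals cogenerate the category of `ℝ[X]`-modules. -/
theorem exists_hom_smooth_ne_zero {N : Type} [AddCommGroup N] [Module ℝ[X] N] {n : N}
    (hn : n ≠ 0) : ∃ φ : N →ₗ[ℝ[X]] Smooth, φ n ≠ 0 := by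
  obtain ⟨d, hd⟩ := (IsPrincipalIdealRing.principal (Ideal.torsionOf ℝ[X] N n)).principal
  have hdu : ¬ IsUnit d := fun hu => hn <| by
    have h1 : Ideal.torsionOf ℝ[X] N n = ⊤ := hd.trans (Ideal.span_singleton_eq_top.mpr hu)
    exact (Ideal.torsionOf_eq_top_iff ℝ[X] n).mp h1
  obtain ⟨f, hf0, hf⟩ := exists_ne_zero_smul_eq_zero hdu
  have hle : Ideal.torsionOf ℝ[X] N n ≤ LinearMap.ker (LinearMap.toSpanSingleton ℝ[X] Smooth f) := by
    rw [hd]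
    refine (Submodule.span_singleton_le_iff_mem _ _).mpr ?_
    simpa using hf
  -- The cyclic module of `n` is `ℝ[X]/(d)`, where `1 ↦ f` is well defined because `d • f = 0`;
  -- injectivity extends this map to `N`.
  obtain ⟨φ, hφ⟩ := baer_smooth.extension_property (ℝ[X] ∙ n).subtype
    (Submodule.subtype_injective _) ((Submodule.liftQ _ _ hle).comp
      (Ideal.quotTorsionOfEquivSpanSingleton ℝ[X] N n).symm.toLinearMap)
  refine ⟨φ, ?_⟩
  have h1 := LinearMap.congr_fun hφ ⟨n, Submodule.mem_span_singleton_self n⟩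
  have h2 : (Ideal.quotTorsionOfEquivSpanSingleton ℝ[X] N n).symm
      ⟨n, Submodule.mem_span_singleton_self n⟩ = Submodule.Quotient.mk 1 := by
    rw [LinearEquiv.symm_apply_eq, Ideal.quotTorsionOfEquivSpanSingleton_apply_mk]
    ext; simp
  simp only [LinearMap.comp_apply, LinearEquiv.coe_coe, Submodule.subtype_apply] at h1
  rw [h1, h2, Submodule.liftQ_apply]
  simpa using hf0

/-- A row operator annihilating the behavior of `A` is a polynomial combination of rows of `A`. -/
theorem exists_vecMul_eq_of_annihilates {m n : Type} [Fintype m] [Fintype n] [DecidableEq n]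
    (A : Matrix m n ℝ[X]) (b : n → ℝ[X])
    (h : ∀ w : n → Smooth, (∀ i, ∑ j, A i j • w j = 0) → ∑ j, b j • w j = 0) :
    ∃ y : m → ℝ[X], Matrix.vecMul y A = b := by
  suffices hb : b ∈ Submodule.span ℝ[X] (Set.range A.row) by
    obtain ⟨y, hy⟩ := (Submodule.mem_span_range_iff_exists_fun ℝ[X]).mp hb
    exact ⟨y, by rw [Matrix.vecMul_eq_sum]; exact hy⟩
  by_contra hb
  obtain ⟨φ, hφ⟩ := exists_hom_smooth_ne_zero
    (n := (Submodule.span ℝ[X] (Set.range A.row)).mkQ b) (by simpa using hb)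
  -- The images of the standard basis vectors form a trajectory on which every row `v` acts as `φ`
  -- of its class: the rows of `A` kill it, `b` does not.
  have key (v : n → ℝ[X]) : ∑ j, v j • φ (Submodule.mkQ _ (Pi.single j 1)) =
      φ (Submodule.mkQ (Submodule.span ℝ[X] (Set.range A.row)) v) := by
    conv_rhs => rw [pi_eq_sum_univ' v]
    simp only [map_sum, map_smul]
  refine hφ ?_
  rw [← key]
  refine h _ fun i => ?_
  rw [key (A i)]
  have : Submodule.mkQ (Submodule.span ℝ[X] (Set.range A.row)) (A i) = 0 := by
    rw [Submodule.mkQ_apply, Submodule.Quotient.mk_eq_zero]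
    exact Submodule.subset_span (Set.mem_range_self (f := A.row) i)
  rw [this, map_zero]

theorem exists_mul_eq_of_annihilates {l m n : Type} [Fintype m] [Fintype n] [DecidableEq n]
    (A : Matrix m n ℝ[X]) (B : Matrix l n ℝ[X])
    (h : ∀ w : n → Smooth, (∀ i, ∑ j, A i j • w j = 0) → ∀ i, ∑ j, B i j • w j = 0) :
    ∃ F : Matrix l m ℝ[X], F * A = B := by
  choose F hF using fun i => exists_vecMul_eq_of_annihilates A (B i) fun w hw => h w hw i
  exact ⟨Matrix.of F, funext hF⟩

/-! ### Kernel inclusions as matrix factorizations -/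

theorem mem_ker_iff {g q : ℕ} {A : Matrix (Fin g) (Fin q) ℝ[X]} {w : Traj q} :
    w ∈ ker A ↔ ∀ i, ∑ j, A i j • w j = 0 := funext_iff

theorem diffOp_mul {g q r : ℕ} (A : Matrix (Fin g) (Fin q) ℝ[X])
    (B : Matrix (Fin q) (Fin r) ℝ[X]) (w : Traj r) : diffOp (A * B) w = diffOp A (diffOp B w) := by
  funext i
  change ∑ j, (∑ x, A i x * B x j) • w j = ∑ x, A i x • ∑ j, B x j • w j
  simp only [Finset.sum_smul, Finset.smul_sum, mul_smul]
  exact Finset.sum_comm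

theorem diffOp_add {g q : ℕ} (A B : Matrix (Fin g) (Fin q) ℝ[X]) (w : Traj q) :
    diffOp (A + B) w = diffOp A w + diffOp B w := by
  funext i
  change ∑ j, (A i j + B i j) • w j = ∑ j, A i j • w j + ∑ j, B i j • w j
  simp only [add_smul, Finset.sum_add_distrib]

theorem diffOp_zero {g q : ℕ} (A : Matrix (Fin g) (Fin q) ℝ[X]) : diffOp A 0 = 0 := by
  funext i
  change ∑ j, A i j • (0 : Smooth) = 0
  simp

theorem ker_subset_ker_mul {g q r : ℕ} (A : Matrix (Fin g) (Fin q) ℝ[X])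
    (B : Matrix (Fin q) (Fin r) ℝ[X]) : ker B ⊆ ker (A * B) := fun w hw => by
  change diffOp (A * B) w = 0
  rw [diffOp_mul, show diffOp B w = 0 from hw, diffOp_zero]

theorem ker_mul_of_leftInverse {g q r : ℕ} {A : Matrix (Fin g) (Fin q) ℝ[X]}
    {A' : Matrix (Fin q) (Fin g) ℝ[X]} (h : A' * A = 1) (B : Matrix (Fin q) (Fin r) ℝ[X]) :
    ker (A * B) = ker B := by
  refine Set.Subset.antisymm ?_ (ker_subset_ker_mul A B)
  have := ker_subset_ker_mul A' (A * B)
  rwa [← Matrix.mul_assoc, h, Matrix.one_mul] at this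

theorem ker_mul_add_inter_ker {k p q : ℕ} (V : Matrix (Fin k) (Fin p) ℝ[X])
    (P : Matrix (Fin p) (Fin q) ℝ[X]) (C : Matrix (Fin k) (Fin q) ℝ[X]) :
    ker (V * P + C) ∩ ker P = ker C ∩ ker P := by
  ext w
  refine and_congr_left fun hw => ?_
  change diffOp (V * P + C) w = 0 ↔ diffOp C w = 0
  rw [diffOp_add, show diffOp (V * P) w = 0 from ker_subset_ker_mul V P hw, zero_add]

theorem exists_eq_mul_of_ker_subset {g h q : ℕ} {A : Matrix (Fin g) (Fin q) ℝ[X]}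
    {B : Matrix (Fin h) (Fin q) ℝ[X]} (hAB : ker A ⊆ ker B) :
    ∃ F : Matrix (Fin h) (Fin g) ℝ[X], B = F * A := by
  obtain ⟨F, hF⟩ := exists_mul_eq_of_annihilates A B fun w hw =>
    mem_ker_iff.mp (hAB (mem_ker_iff.mpr hw))
  exact ⟨F, hF.symm⟩

theorem exists_eq_mul_add_mul_of_ker_inter_subset {g g' h q : ℕ}
    {A : Matrix (Fin g) (Fin q) ℝ[X]} {A' : Matrix (Fin g') (Fin q) ℝ[X]}
    {B : Matrix (Fin h) (Fin q) ℝ[X]} (hAB : ker A ∩ ker A' ⊆ ker B) :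
    ∃ (X : Matrix (Fin h) (Fin g) ℝ[X]) (Y : Matrix (Fin h) (Fin g') ℝ[X]),
      B = X * A + Y * A' := by
  obtain ⟨F, hF⟩ := exists_mul_eq_of_annihilates (Matrix.fromRows A A') B fun w hw =>
    mem_ker_iff.mp (hAB ⟨mem_ker_iff.mpr fun i => hw (Sum.inl i),
      mem_ker_iff.mpr fun i => hw (Sum.inr i)⟩)
  refine ⟨F.toCols₁, F.toCols₂, ?_⟩
  rw [← Matrix.fromCols_mul_fromRows, Matrix.fromCols_toCols, hF]

/-- The rows of a kernel representation of the control manifest behavior come from left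
annihilators of `R`. -/
theorem exists_annihilator_of_controlManifest_subset {g nw nc p : ℕ}
    {R : Matrix (Fin g) (Fin nw) ℝ[X]} {M : Matrix (Fin g) (Fin nc) ℝ[X]}
    {P : Matrix (Fin p) (Fin nc) ℝ[X]} (h : controlManifest R M ⊆ ker P) :
    ∃ Y : Matrix (Fin p) (Fin g) ℝ[X], Y * R = 0 ∧ Y * M = P := by
  -- The operator `[0 P]` vanishes on the full plant behavior, so it is a left multiple of `[R M]`.
  obtain ⟨Y, hY⟩ := exists_mul_eq_of_annihilates (Matrix.fromCols R M)
    (Matrix.fromCols (0 : Matrix (Fin p) (Fin nw) ℝ[X]) P) fun w hw => by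
      have hc : (fun j => w (Sum.inr j)) ∈ ker P := h ⟨fun j => w (Sum.inl j), funext fun i => by
        have := hw i
        rw [Fintype.sum_sum_type] at this
        exact this⟩
      intro i
      have := mem_ker_iff.mp hc i
      rw [Fintype.sum_sum_type]
      simpa using this
  rw [Matrix.mul_fromCols] at hY
  exact ⟨Y, Matrix.fromCols_inj.eq_iff.mp hY |>.1, Matrix.fromCols_inj.eq_iff.mp hY |>.2⟩

/-! ### Rank conditions and regularity -/

/-- By the dimension formula, maximal rank growth forces the rows of `B` to be independent and the
two row spaces to meet only in zero. -/
theorem rank_fromRows_eq_add_card {K : Type*} [Field K] {l m n : Type*} [Fintype l] [Fintype m]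
    [Fintype n] {A : Matrix m n K} {B : Matrix l n K}
    (h : (Matrix.fromRows A B).rank = A.rank + Fintype.card l) :
    B.rank = Fintype.card l ∧
      ∀ (y : m → K) (z : l → K), Matrix.vecMul y A + Matrix.vecMul z B = 0 → z = 0 := by
  have hsup : Submodule.span K (Set.range (Matrix.fromRows A B).row) =
      Submodule.span K (Set.range A.row) ⊔ Submodule.span K (Set.range B.row) := by
    rw [← Submodule.span_union]
    congr 1
    exact Set.Sum.elim_range A B
  have hdim := Submodule.finrank_sup_add_finrank_inf_eq
    (Submodule.span K (Set.range A.row)) (Submodule.span K (Set.range B.row))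
  rw [← hsup, ← Matrix.rank_eq_finrank_span_row, ← Matrix.rank_eq_finrank_span_row,
    ← Matrix.rank_eq_finrank_span_row, h] at hdim
  have hB : B.rank ≤ Fintype.card l := B.rank_le_card_height
  have hBr : B.rank = Fintype.card l := by omega
  have hinf : Submodule.span K (Set.range A.row) ⊓ Submodule.span K (Set.range B.row) = ⊥ :=
    Submodule.finrank_eq_zero.mp (by omega)
  refine ⟨hBr, fun y z hyz => ?_⟩
  have hli : LinearIndependent K B.row := by
    rw [linearIndependent_iff_card_eq_finrank_span, Set.finrank,
      ← Matrix.rank_eq_finrank_span_row, hBr]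
  have hzB : Matrix.vecMul z B ∈
      Submodule.span K (Set.range A.row) ⊓ Submodule.span K (Set.range B.row) := by
    refine ⟨?_, (Submodule.mem_span_range_iff_exists_fun K).mpr ⟨z, ?_⟩⟩
    · refine (Submodule.mem_span_range_iff_exists_fun K).mpr ⟨-y, ?_⟩
      rw [eq_neg_of_add_eq_zero_right hyz, ← Matrix.neg_vecMul, Matrix.vecMul_eq_sum]
      rfl
    · rw [Matrix.vecMul_eq_sum]
      rfl
  rw [hinf, Submodule.mem_bot, Matrix.vecMul_eq_sum] at hzB
  exact funext (Fintype.linearIndependent_iff.mp hli z hzB)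

theorem polyRank_mul_le_right {l m n : Type} [Fintype m] [Fintype n]
    (A : Matrix l m ℝ[X]) (B : Matrix m n ℝ[X]) : polyRank (A * B) ≤ polyRank B := by
  unfold polyRank
  rw [Matrix.map_mul]
  exact Matrix.rank_mul_le_right _ _

theorem polyRank_mul_le_left {l m n : Type} [Fintype m] [Fintype n]
    (A : Matrix l m ℝ[X]) (B : Matrix m n ℝ[X]) : polyRank (A * B) ≤ polyRank A := by
  unfold polyRank
  rw [Matrix.map_mul]
  exact Matrix.rank_mul_le_left _ _

section Regularity

variable {g nw nc k : ℕ} {R : Matrix (Fin g) (Fin nw) ℝ[X]} {M : Matrix (Fin g) (Fin nc) ℝ[X]}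

theorem polyRank_fromBlocks_mul_add_le (R : Matrix (Fin g) (Fin nw) ℝ[X])
    (M : Matrix (Fin g) (Fin nc) ℝ[X]) {h : ℕ} (C : Matrix (Fin k) (Fin nc) ℝ[X])
    (Y : Matrix (Fin h) (Fin g) ℝ[X]) (hY : Y * R = 0) (U : Matrix (Fin h) (Fin k) ℝ[X]) :
    polyRank (Matrix.fromBlocks R M 0 (Y * M + U * C)) ≤ polyRank (Matrix.fromBlocks R M 0 C) := by
  have : Matrix.fromBlocks R M 0 (Y * M + U * C) =
      Matrix.fromBlocks 1 0 Y U * Matrix.fromBlocks R M 0 C := by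
    simp [Matrix.fromBlocks_multiply, hY]
  rw [this]
  exact polyRank_mul_le_right _ _

/-- Consequences of the rank condition defining regularity: the controller has full row rank
and its rows are independent of those of the plant. -/
theorem fullRowRank_and_eq_zero_of_polyRank_fromBlocks {C : Matrix (Fin k) (Fin nc) ℝ[X]}
    (h : polyRank (Matrix.fromBlocks R M 0 C) = polyRank (Matrix.fromCols R M) + k) :
    FullRowRank C ∧ ∀ (l : ℕ) (Y : Matrix (Fin l) (Fin g) ℝ[X]) (Z : Matrix (Fin l) (Fin k) ℝ[X]),
      Y * R = 0 → Y * M + Z * C = 0 → Z = 0 := by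
  set f := algebraMap ℝ[X] (RatFunc ℝ) with hf
  have hinj : Function.Injective f := IsFractionRing.injective ℝ[X] (RatFunc ℝ)
  have hblock : (Matrix.fromBlocks R M 0 C).map f =
      Matrix.fromRows ((Matrix.fromCols R M).map f)
        ((Matrix.fromCols (0 : Matrix (Fin k) (Fin nw) ℝ[X]) C).map f) := by
    ext (i | i) (j | j) <;> rfl
  unfold polyRank at h
  rw [← hf, hblock] at h
  obtain ⟨hr, hz⟩ := rank_fromRows_eq_add_card (h.trans (by rw [Fintype.card_fin]))
  constructor
  · refine le_antisymm ((Matrix.rank_le_card_height _).trans_eq (Fintype.card_fin k)) ?_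
    rw [Fintype.card_fin] at hr
    -- `[0 C] = C * [0 1]`, so its rank is at most that of `C`.
    have h2 := polyRank_mul_le_left C
      (Matrix.fromCols (0 : Matrix (Fin nc) (Fin nw) ℝ[X]) (1 : Matrix (Fin nc) (Fin nc) ℝ[X]))
    rw [Matrix.mul_fromCols, Matrix.mul_zero, Matrix.mul_one] at h2
    exact hr.symm.trans_le h2
  · intro l Y Z hYR hYZ
    have hsum : Y * Matrix.fromCols R M +
        Z * Matrix.fromCols (0 : Matrix (Fin k) (Fin nw) ℝ[X]) C = 0 := by
      rw [Matrix.mul_fromCols, Matrix.mul_fromCols, hYR, Matrix.mul_zero]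
      refine Matrix.ext fun i j => ?_
      rcases j with j | j
      · simp
      · simpa using congrFun (congrFun hYZ i) j
    have hmap := congrArg (fun A => A.map f) hsum
    simp only [Matrix.map_add f (map_add f), Matrix.map_mul, Matrix.map_zero f (map_zero f)] at hmap
    refine Matrix.ext fun i j => ?_
    have hi := hz (Y.map f i) (Z.map f i) (congrFun hmap i)
    exact hinj ((congrFun hi j).trans (map_zero f).symm)

/-- Regularity provides only some representation. Two representations of the same kernel are left
multiples of each other, so all the ranks involved agree. -/
theorem polyRank_fromBlocks_of_isRegularController {C : Matrix (Fin k) (Fin nc) ℝ[X]}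
    (hC : FullRowRank C) (h : IsRegularController R M (ker C)) :
    polyRank (Matrix.fromBlocks R M 0 C) = polyRank (Matrix.fromCols R M) + k := by
  obtain ⟨k', C', -, hker, hrank⟩ := h
  obtain ⟨U, hU⟩ := exists_eq_mul_of_ker_subset hker.subset
  obtain ⟨U', hU'⟩ := exists_eq_mul_of_ker_subset hker.symm.subset
  have hle := polyRank_fromBlocks_mul_add_le R M C 0 (Matrix.zero_mul R) U
  have hle' := polyRank_fromBlocks_mul_add_le R M C' 0 (Matrix.zero_mul R) U'
  rw [Matrix.zero_mul, zero_add, ← hU] at hle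
  rw [Matrix.zero_mul, zero_add, ← hU'] at hle'
  have hr : polyRank C' ≤ polyRank C := hU ▸ polyRank_mul_le_right U C
  have hr' : polyRank C ≤ polyRank C' := by
    conv_lhs => rw [hU']
    exact polyRank_mul_le_right U' C'
  rw [le_antisymm hle' hle, hrank, le_antisymm hr hr', hC]

/-- The rows added are combinations of plant rows, and the row operation is undone by `-V`. -/
theorem polyRank_fromBlocks_add_mul {p : ℕ} {P : Matrix (Fin p) (Fin nc) ℝ[X]}
    (hP : ∃ Y : Matrix (Fin p) (Fin g) ℝ[X], Y * R = 0 ∧ Y * M = P)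
    (C : Matrix (Fin k) (Fin nc) ℝ[X]) (V : Matrix (Fin k) (Fin p) ℝ[X]) :
    polyRank (Matrix.fromBlocks R M 0 (V * P + C)) = polyRank (Matrix.fromBlocks R M 0 C) := by
  obtain ⟨Y, hYR, rfl⟩ := hP
  have hVY : V * Y * R = 0 := by rw [Matrix.mul_assoc, hYR, Matrix.mul_zero]
  apply le_antisymm
  · have := polyRank_fromBlocks_mul_add_le R M C (V * Y) hVY 1
    rwa [Matrix.one_mul, Matrix.mul_assoc] at this
  · have := polyRank_fromBlocks_mul_add_le R M (V * (Y * M) + C) (-(V * Y))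
      (by rw [Matrix.neg_mul, hVY, neg_zero]) 1
    rwa [Matrix.one_mul, Matrix.neg_mul, Matrix.mul_assoc, neg_add_cancel_left] at this

end Regularity

/-! ### Comparison of equivalent regular controllers -/

/-- If `A = X P + Y B` and `B = X' P + Y' A`, and the rows of `A` are independent modulo those
of `P`, then `Y'` is a right inverse of `Y`. -/
theorem mul_eq_one_of_independent {k k' p q : ℕ} {P : Matrix (Fin p) (Fin q) ℝ[X]}
    {A : Matrix (Fin k) (Fin q) ℝ[X]} {B : Matrix (Fin k') (Fin q) ℝ[X]}
    {X : Matrix (Fin k) (Fin p) ℝ[X]} {Y : Matrix (Fin k) (Fin k') ℝ[X]}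
    {X' : Matrix (Fin k') (Fin p) ℝ[X]} {Y' : Matrix (Fin k') (Fin k) ℝ[X]}
    (hA : A = X * P + Y * B) (hB : B = X' * P + Y' * A)
    (hind : ∀ (W : Matrix (Fin k) (Fin p) ℝ[X]) (Z : Matrix (Fin k) (Fin k) ℝ[X]),
      W * P + Z * A = 0 → Z = 0) : Y * Y' = 1 := by
  refine sub_eq_zero.mp (hind (X + Y * X') _ ?_)
  calc (X + Y * X') * P + (Y * Y' - 1) * A = X * P + Y * (X' * P + Y' * A) - A := by
        simp only [Matrix.add_mul, Matrix.sub_mul, Matrix.mul_add, Matrix.mul_assoc,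
          Matrix.one_mul]
        abel
    _ = 0 := by rw [← hB, ← hA, sub_self]

end Behavior

open Behavior

theorem mainTheorem1 {nw nc g s p k : ℕ}
    (R : Matrix (Fin g) (Fin nw) ℝ[X]) (M : Matrix (Fin g) (Fin nc) ℝ[X])
    (S : Matrix (Fin s) (Fin nw) ℝ[X])
    (Pc : Matrix (Fin p) (Fin nc) ℝ[X]) (C : Matrix (Fin k) (Fin nc) ℝ[X])
    (hPc : Behavior.controlManifest R M = Behavior.ker Pc)
    (hPc_rank : Behavior.FullRowRank Pc)
    (hC : Behavior.ker C ∈ Behavior.canReg R M (Behavior.ker S))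
    (hC_rank : Behavior.FullRowRank C)
    (𝒞' : Set (Behavior.Traj nc)) :
    𝒞' ∈ Behavior.canReg R M (Behavior.ker S) ↔
      ∃ V : Matrix (Fin k) (Fin p) ℝ[X], 𝒞' = Behavior.ker (V * Pc + C) := by
  obtain ⟨hCreg, hCcan⟩ := hC
  have hY := exists_annihilator_of_controlManifest_subset hPc.subset
  have hrank := polyRank_fromBlocks_of_isRegularController hC_rank hCreg
  have hind {k' : ℕ} {D : Matrix (Fin k') (Fin nc) ℝ[X]}
      (hD : polyRank (Matrix.fromBlocks R M 0 D) = polyRank (Matrix.fromCols R M) + k')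
      (W : Matrix (Fin k') (Fin p) ℝ[X]) (Z : Matrix (Fin k') (Fin k') ℝ[X])
      (hWZ : W * Pc + Z * D = 0) : Z = 0 := by
    obtain ⟨Y, hYR, hYM⟩ := hY
    refine (fullRowRank_and_eq_zero_of_polyRank_fromBlocks hD).2 k' (W * Y) Z ?_ ?_
    · rw [Matrix.mul_assoc, hYR, Matrix.mul_zero]
    · rw [Matrix.mul_assoc, hYM, hWZ]
  constructor
  · rintro ⟨⟨k', C', hC'_rank, rfl, hC'_reg⟩, hC'_can⟩
    have hinter : ker C' ∩ ker Pc = ker C ∩ ker Pc := by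
      rw [← hPc, hC'_can, hCcan]
    rw [show polyRank C' = k' from hC'_rank] at hC'_reg
    obtain ⟨X, Y, hXY⟩ := exists_eq_mul_add_mul_of_ker_inter_subset
      (A := Pc) (A' := C) (B := C') fun w hw => (hinter.ge ⟨hw.2, hw.1⟩).1
    obtain ⟨X', Y', hXY'⟩ := exists_eq_mul_add_mul_of_ker_inter_subset
      (A := Pc) (A' := C') (B := C) fun w hw => (hinter.le ⟨hw.2, hw.1⟩).1
    have hYY' : Y * Y' = 1 := mul_eq_one_of_independent hXY hXY' (hind hC'_reg)
    have hY'Y : Y' * Y = 1 := mul_eq_one_of_independent hXY' hXY (hind hrank)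
    -- `Y'` has left inverse `Y`, so `C'` and `Y' * C' = Y' * X * Pc + C` have the same kernel.
    refine ⟨Y' * X, ?_⟩
    rw [← ker_mul_of_leftInverse hYY' C', hXY, Matrix.mul_add, ← Matrix.mul_assoc,
      ← Matrix.mul_assoc, hY'Y, Matrix.one_mul]
  · rintro ⟨V, rfl⟩
    have hV := (polyRank_fromBlocks_add_mul hY C V).trans hrank
    -- Full row rank is itself forced by the rank of the block matrix exceeding that of the plant by
    -- `k`.
    have hfull := (fullRowRank_and_eq_zero_of_polyRank_fromBlocks hV).1
    refine ⟨⟨k, V * Pc + C, hfull, rfl, hV.trans (by rw [show polyRank _ = k from hfull])⟩, ?_⟩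
    rw [← hCcan, hPc, ker_mul_add_inter_ker]
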